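/- There is a universal constant $C>0$ such that the following holds. Let $m_1,m_2\ge 1$, $K\ge 0$, $0\le r\le \min(m_1,m_2)$, sample sizes $n_0\ge 1$ and $n_1,\dots,n_K\ge 0$, $v\ge 0$, $h\ge 0$; put $M=\max(m_1,m_2)$ and $N=\sum_{k=0}^K n_k$. For $k=0,1,\dots,K$ and $i=1,\dots,n_k$ one observes $(X_i^{(k)},Y_i^{(k)})$ with $$Y_i^{(k)}=\langle X_i^{(k)},A_k\rangle+\xi_i^{(k)},\qquad \langle A,B\rangle=\operatorname{tr}(A^{T}B),$$ where the pairs $(X_i^{(k)},\xi_i^{(k)})$ are independent, $X_i^{(k)}$ is independent of $\xi_i^{(k)}$, $X_i^{(k)}$ is uniformly distributed on the $m_1m_2$ canonical matrices $e_je_l^{T}\in\mathbb R^{m_1\times m_2}$, and $\xi_i^{(k)}$ is Gaussian with mean $0$ and variance $v^2$. Let $$\Omega_h=\Big\{(A_0,A_1,\dots,A_K)\in(\mathbb R^{m_1\times m_2})^{K+1}:\ \operatorname{rank}(A_0)\le r,\ \max_{1\le k\le K}\|A_k-A_0\|_*\le h\Big\},$$ where $\|\cdot\|_*$ is the nuclear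 norm (sum of the singular values), and let $$C_h=\sqrt{\frac{h^2}{m_1m_2}\cdot\frac{v^2M}{n_0}}.$$ Then $$\inf_{\hat A}\ \sup_{(A_0,\dots,A_K)\in\Omega_h}\ \mathbb P\left(\frac{\|\hat A-A_0\|_F^2}{m_1m_2}\ \ge\ C\left(\frac{v^2rM}{N}+\Big(\frac{v^2rM}{n_0}\wedge C_h\wedge\frac{h^2}{m_1m_2}\Big)\right)\right)\ \ge\ \frac14,$$ where the infimum is over all estimators of $A_0$, that is, all measurable functions $\hat A$ of the target and source data with values in $\mathbb R^{m_1\times m_2}$, and $\|\cdot\|_F$ is the Frobenius norm. -/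

import Mathlib

open MeasureTheory ProbabilityTheory
open scoped ENNReal NNReal

namespace TransferMC

/-- Matrices carry the product (Borel) σ-algebra, generated by the entries. -/
instance matrixMeasurableSpace (m₁ m₂ : ℕ) : MeasurableSpace (Matrix (Fin m₁) (Fin m₂) ℝ) :=
  inferInstanceAs (MeasurableSpace (Fin m₁ → Fin m₂ → ℝ))

/-- Frobenius inner product `⟨A, B⟩ = tr(Aᵀ B)`. -/
def frobInner {m₁ m₂ : ℕ} (A B : Matrix (Fin m₁) (Fin m₂) ℝ) : ℝ :=
  (A.transpose * B).trace

/-- Frobenius norm. -/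
noncomputable def frobNorm {m₁ m₂ : ℕ} (A : Matrix (Fin m₁) (Fin m₂) ℝ) : ℝ :=
  Real.sqrt (∑ i, ∑ j, A i j ^ 2)

/-- Nuclear norm: the sum of the `min m₁ m₂` singular values of `A`. -/
noncomputable def nuclearNorm {m₁ m₂ : ℕ} (A : Matrix (Fin m₁) (Fin m₂) ℝ) : ℝ :=
  ∑ l ∈ Finset.range (min m₁ m₂), (Matrix.toEuclideanLin A).singularValues l

/-- The uniform distribution on the canonical matrices `e_j e_lᵀ`: each has mass `1 / (m₁ m₂)`. -/
noncomputable def uniformSampling (m₁ m₂ : ℕ) : Measure (Matrix (Fin m₁) (Fin m₂) ℝ) :=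
  ∑ j : Fin m₁, ∑ l : Fin m₂,
    ((m₁ : ℝ≥0∞) * (m₂ : ℝ≥0∞))⁻¹ • Measure.dirac (Matrix.single j l (1 : ℝ))

/-- The parameter space: families `(A_0, A_1, …, A_K)` with `rank A_0 ≤ r` and
`‖A_k - A_0‖_* ≤ h` for every source index `k = 1, …, K`. -/
def paramSpace (m₁ m₂ K r : ℕ) (h : ℝ) : Set (Fin (K + 1) → Matrix (Fin m₁) (Fin m₂) ℝ) :=
  {A | (A 0).rank ≤ r ∧ ∀ k : Fin K, nuclearNorm (A k.succ - A 0) ≤ h}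

/-- The space of all the observations `(X_i^{(k)}, Y_i^{(k)})`, for `0 ≤ k ≤ K` and `i` in
`Fin (n k)`; index `0` is the target data set. -/
abbrev DataSpace (m₁ m₂ K : ℕ) (n : Fin (K + 1) → ℕ) : Type :=
  (k : Fin (K + 1)) → Fin (n k) → Matrix (Fin m₁) (Fin m₂) ℝ × ℝ

/-- The data generated from the matrices `A`, the sampling matrices `X` and the noises `ξ`:
`Y_i^{(k)} = ⟨X_i^{(k)}, A_k⟩ + ξ_i^{(k)}`. -/
def observations {m₁ m₂ K : ℕ} {n : Fin (K + 1) → ℕ} {Ω : Type*}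
    (X : (k : Fin (K + 1)) → Fin (n k) → Ω → Matrix (Fin m₁) (Fin m₂) ℝ)
    (ξ : (k : Fin (K + 1)) → Fin (n k) → Ω → ℝ)
    (A : Fin (K + 1) → Matrix (Fin m₁) (Fin m₂) ℝ) (ω : Ω) : DataSpace m₁ m₂ K n :=
  fun k i => (X k i ω, frobInner (X k i ω) (A k) + ξ k i ω)

/-- An estimator of `A_0`: a measurable function of all the data. -/
def Estimator (m₁ m₂ K : ℕ) (n : Fin (K + 1) → ℕ) : Type :=
  {f : DataSpace m₁ m₂ K n → Matrix (Fin m₁) (Fin m₂) ℝ // Measurable f}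

/-- `C_h = √( h² / (m₁ m₂) · v² M / n₀ )` with `M = max m₁ m₂`. -/
noncomputable def cTerm (m₁ m₂ n₀ : ℕ) (v h : ℝ) : ℝ :=
  Real.sqrt (h ^ 2 / ((m₁ : ℝ) * m₂) * (v ^ 2 * (max m₁ m₂ : ℕ) / n₀))

/-- The rate `v² r M / N + (v² r M / n₀) ∧ C_h ∧ (h² / (m₁ m₂))`, where `M = max m₁ m₂` and
`N` is the total sample size. -/
noncomputable def lowerRate (m₁ m₂ r n₀ N : ℕ) (v h : ℝ) : ℝ :=
  v ^ 2 * r * (max m₁ m₂ : ℕ) / N +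
    min (v ^ 2 * r * (max m₁ m₂ : ℕ) / n₀)
      (min (cTerm m₁ m₂ n₀ v h) (h ^ 2 / ((m₁ : ℝ) * m₂)))

end TransferMC

/-!
The two terms of the rate are handled separately, since their sum is at most twice the larger one.
Each comes from the same experiment: the entries of `A_0` at a set `S` of positions are `0` or `δ`,
freely, and all the other entries vanish. The set `S` consists of `s ≤ r` full lines in the long
direction, so it has `s M` elements and forces the rank to be at most `s`
(`exists_support_rank_le`).

For the term `v² r M / N` all the sources have the same matrix as the target, and `s = r`. For the
other term all the sources have the matrix `0`, hence only the `n₀` target observations are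
informative; the constraint is then `‖A_0‖_* ≤ h`, which follows from `‖A_0‖_* ≤ √s ‖A_0‖_F`
(`nuclearNorm_sq_le`), and `s` and `δ` are tuned to the three regimes of the minimum
(`exists_cube_of_target`).

Changing a single entry of `A_0` by `δ` changes the law of the data only through the observations at
that entry, whose expected number is `n / (m₁ m₂)` for `n` informative observations. The likelihood
ratio is a product of Gaussian ones, so the affinity (the mean of its square root) is
multiplicative, at least `1 - n δ² / (8 v² m₁ m₂)`; therefore, if `δ² ≤ v² m₁ m₂ / (4 n)`, no event
changes its probability by more than `1/4` (`measureReal_pi_shift_sub_le`,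
`measureReal_dataOf_sub_le`). Affinities are used rather than `χ²`-divergences because the latter
involve `exp (δ² / v²)`, which is unbounded when `n` is much smaller than `m₁ m₂`.

By Assouad's averaging over the hypercube, thresholding an estimator at `δ / 2` then errs on average
in at least `3/8` of the entries in `S`; as it never errs in more than all of them, at some vertex
it errs in an eighth of them with probability at least `1/4` (`exists_vertex_errorCount`). Each
error costs `δ² / 4` in squared Frobenius norm, whence a loss of at least `s M δ² / 32`
(`exists_vertex_le_frobNorm_sq`).
-/

namespace TransferMC

/-! ### Affinity and total variation -/

lemma integrable_sq_of_isFiniteMeasure_withDensity {α : Type*} [MeasurableSpace α]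
    {P : Measure α} {G : α → ℝ} (hG : Measurable G)
    [IsFiniteMeasure (P.withDensity fun x => ENNReal.ofReal (G x ^ 2))] :
    Integrable (fun x => G x ^ 2) P := by
  refine ⟨(hG.pow_const 2).aestronglyMeasurable, ?_⟩
  rw [hasFiniteIntegral_iff_ofReal (Filter.Eventually.of_forall fun x => sq_nonneg _)]
  have := measure_lt_top (P.withDensity fun x => ENNReal.ofReal (G x ^ 2)) Set.univ
  rwa [withDensity_apply _ MeasurableSet.univ, Measure.restrict_univ] at this

lemma measureReal_withDensity_sq {α : Type*} [MeasurableSpace α]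
    {P : Measure α} {G : α → ℝ} (hG : Measurable G)
    [IsFiniteMeasure (P.withDensity fun x => ENNReal.ofReal (G x ^ 2))]
    {E : Set α} (hE : MeasurableSet E) :
    (P.withDensity fun x => ENNReal.ofReal (G x ^ 2)).real E = ∫ x in E, G x ^ 2 ∂P := by
  rw [measureReal_def, withDensity_apply _ hE,
    ← ofReal_integral_eq_lintegral_ofReal
      (integrable_sq_of_isFiniteMeasure_withDensity hG).integrableOn
      (Filter.Eventually.of_forall fun x => sq_nonneg _),
    ENNReal.toReal_ofReal (integral_nonneg fun x => sq_nonneg _)]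

lemma integrable_of_isFiniteMeasure_withDensity_sq {α : Type*} [MeasurableSpace α]
    {P : Measure α} [IsFiniteMeasure P] {G : α → ℝ} (hG : Measurable G)
    [IsFiniteMeasure (P.withDensity fun x => ENNReal.ofReal (G x ^ 2))] :
    Integrable G P := by
  refine Integrable.mono' ((integrable_sq_of_isFiniteMeasure_withDensity hG).add
    (integrable_const 1)) hG.aestronglyMeasurable (Filter.Eventually.of_forall fun x => ?_)
  simp only [Pi.add_apply, Real.norm_eq_abs]
  nlinarith [sq_nonneg (|G x| - 1), sq_abs (G x)]

/-- If `Q` has density `G²` with respect to `P`, the excess `Q(E) - P(E)` is controlled by the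
affinity `∫ G dP`. The free parameter `t` comes from the arithmetic-geometric mean inequality, used
here in place of the Cauchy–Schwarz inequality. -/
lemma measureReal_withDensity_sq_sub_le {α : Type*} [MeasurableSpace α]
    {P : Measure α} [IsProbabilityMeasure P] {G : α → ℝ} (hG : Measurable G)
    [IsProbabilityMeasure (P.withDensity fun x => ENNReal.ofReal (G x ^ 2))]
    {E : Set α} (hE : MeasurableSet E) {t : ℝ} (ht : 0 < t) :
    (P.withDensity fun x => ENNReal.ofReal (G x ^ 2)).real E - P.real E ≤
      (t * (1 - ∫ x, G x ∂P) + 2 / t) / 2 := by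
  have h2 := integrable_sq_of_isFiniteMeasure_withDensity (P := P) hG
  have h1 := integrable_of_isFiniteMeasure_withDensity_sq (P := P) hG
  have htot : ∫ x, G x ^ 2 ∂P = 1 := by
    have := measureReal_withDensity_sq (P := P) hG MeasurableSet.univ
    simpa using this.symm
  have hdiff : (P.withDensity fun x => ENNReal.ofReal (G x ^ 2)).real E - P.real E =
      ∫ x, E.indicator (fun x => G x ^ 2 - 1) x ∂P := by
    rw [integral_indicator hE, integral_sub h2.integrableOn (integrable_const 1).integrableOn,
      measureReal_withDensity_sq hG hE]
    simp
  rw [hdiff]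
  have hbound : ∀ x, E.indicator (fun x => G x ^ 2 - 1) x ≤
      (1 / 2 + t / 4 + 1 / (2 * t)) * G x ^ 2 + (-(t / 2)) * G x
        + (t / 4 + 1 / (2 * t) - 1 / 2) := by
    intro x
    have hamgm : |G x ^ 2 - 1| ≤ t / 2 * (1 - G x) ^ 2 + (1 + G x ^ 2) / t := by
      have h3 : 2 * (|1 - G x| * |1 + G x|) ≤ t * |1 - G x| ^ 2 + |1 + G x| ^ 2 / t := by
        have h4 : 0 ≤ (t * |1 - G x| - |1 + G x|) ^ 2 / t := by positivity
        have h5 : (t * |1 - G x| - |1 + G x|) ^ 2 / t =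
          t * |1 - G x| ^ 2 + |1 + G x| ^ 2 / t - 2 * (|1 - G x| * |1 + G x|) := by
          field_simp; ring
        linarith
      rw [← abs_mul, sq_abs, sq_abs] at h3
      have h6 : |(1 - G x) * (1 + G x)| = |G x ^ 2 - 1| := by
        rw [← abs_neg]; congr 1; ring
      have h7 : (1 + G x) ^ 2 / t ≤ 2 * ((1 + G x ^ 2) / t) := by
        rw [← mul_div_assoc]
        gcongr
        nlinarith [sq_nonneg (1 - G x)]
      rw [h6] at h3
      linarith
    have hid : (1 / 2 + t / 4 + 1 / (2 * t)) * G x ^ 2 + (-(t / 2)) * G x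
        + (t / 4 + 1 / (2 * t) - 1 / 2) =
        (G x ^ 2 - 1) / 2 + (t / 2 * (1 - G x) ^ 2 + (1 + G x ^ 2) / t) / 2 := by
      field_simp; ring
    rw [hid]
    by_cases hx : x ∈ E
    · rw [Set.indicator_of_mem hx]
      linarith [le_abs_self (G x ^ 2 - 1)]
    · rw [Set.indicator_of_notMem hx]
      linarith [neg_abs_le (G x ^ 2 - 1)]
  calc ∫ x, E.indicator (fun x => G x ^ 2 - 1) x ∂P
      ≤ ∫ x, ((1 / 2 + t / 4 + 1 / (2 * t)) * G x ^ 2 + (-(t / 2)) * G x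
        + (t / 4 + 1 / (2 * t) - 1 / 2)) ∂P := by
        refine integral_mono ((h2.sub (integrable_const 1)).indicator hE) ?_ hbound
        exact ((h2.const_mul _).add (h1.const_mul _)).add (integrable_const _)
    _ = (t * (1 - ∫ x, G x ∂P) + 2 / t) / 2 := by
        have h12 : Integrable (fun x => (1 / 2 + t / 4 + 1 / (2 * t)) * G x ^ 2
            + (-(t / 2)) * G x) P := (h2.const_mul _).add (h1.const_mul _)
        rw [integral_add h12 (integrable_const _), integral_add (h2.const_mul _) (h1.const_mul _), integral_const_mul, integral_const_mul,
          htot]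
        simp only [integral_const, probReal_univ, smul_eq_mul]
        field_simp; ring

lemma pi_withDensity_sq {ι : Type*} [Fintype ι] {α : ι → Type*} [∀ i, MeasurableSpace (α i)]
    (P : ∀ i, Measure (α i)) [∀ i, IsFiniteMeasure (P i)] {g : ∀ i, α i → ℝ}
    (hg : ∀ i, Measurable (g i))
    [∀ i, IsFiniteMeasure ((P i).withDensity fun x => ENNReal.ofReal (g i x ^ 2))] :
    Measure.pi (fun i => (P i).withDensity fun x => ENNReal.ofReal (g i x ^ 2)) =
      (Measure.pi P).withDensity fun x => ENNReal.ofReal ((∏ i, g i (x i)) ^ 2) := by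
  refine Measure.pi_eq fun s hs => ?_
  have hint : ∀ i, Integrable (fun x => g i x ^ 2) ((P i).restrict (s i)) := fun i =>
    (integrable_sq_of_isFiniteMeasure_withDensity (hg i)).integrableOn
  rw [withDensity_apply _ (MeasurableSet.univ_pi hs), Measure.restrict_pi_pi]
  simp_rw [← Finset.prod_pow]
  rw [← ofReal_integral_eq_lintegral_ofReal (Integrable.fintype_prod_dep hint)
      (Filter.Eventually.of_forall fun x => Finset.prod_nonneg fun i _ => sq_nonneg _),
    integral_fintype_prod_eq_prod (fun i x => g i x ^ 2),
    ENNReal.ofReal_prod_of_nonneg (fun i _ => integral_nonneg fun x => sq_nonneg _)]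
  refine Finset.prod_congr rfl fun i _ => ?_
  rw [withDensity_apply _ (hs i), ofReal_integral_eq_lintegral_ofReal (hint i)
    (Filter.Eventually.of_forall fun x => sq_nonneg _)]

lemma one_sub_sum_le_prod {ι : Type*} (s : Finset ι) (ρ ε : ι → ℝ) (h0 : ∀ i ∈ s, 0 ≤ ρ i)
    (h1 : ∀ i ∈ s, ρ i ≤ 1) (hε : ∀ i ∈ s, 1 - ε i ≤ ρ i) :
    1 - ∑ i ∈ s, ε i ≤ ∏ i ∈ s, ρ i := by
  classical
  induction s using Finset.induction_on with
  | empty => simp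
  | insert a s ha ih =>
    rw [Finset.sum_insert ha, Finset.prod_insert ha]
    have ih' := ih (fun i hi => h0 i (Finset.mem_insert_of_mem hi))
      (fun i hi => h1 i (Finset.mem_insert_of_mem hi))
      (fun i hi => hε i (Finset.mem_insert_of_mem hi))
    have hp1 : ∏ i ∈ s, ρ i ≤ 1 := Finset.prod_le_one
      (fun i hi => h0 i (Finset.mem_insert_of_mem hi))
      (fun i hi => h1 i (Finset.mem_insert_of_mem hi))
    have ha1 := h1 a (Finset.mem_insert_self a s)
    have ha2 := hε a (Finset.mem_insert_self a s)
    -- `ρ_a p ≥ ρ_a + p - 1` because `(1 - ρ_a) (1 - p) ≥ 0`.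
    nlinarith [mul_nonneg (sub_nonneg.2 ha1) (sub_nonneg.2 hp1)]

/-! ### Gaussian shifts -/

/-- The square root of the likelihood ratio of `N(a, V)` to `N(0, V)` at `y`. -/
noncomputable def sqrtRatio (V : ℝ≥0) (a y : ℝ) : ℝ :=
  Real.exp (a * y / (2 * V) - a ^ 2 / (4 * V))

lemma gaussianReal_eq_withDensity_sqrtRatio {V : ℝ≥0} (hV : V ≠ 0) (a : ℝ) :
    gaussianReal a V =
      (gaussianReal 0 V).withDensity fun y => ENNReal.ofReal (sqrtRatio V a y ^ 2) := by
  have hV' : (V : ℝ) ≠ 0 := by exact_mod_cast hV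
  have hm : Measurable fun y => ENNReal.ofReal (sqrtRatio V a y ^ 2) := by
    unfold sqrtRatio; fun_prop
  rw [gaussianReal_of_var_ne_zero _ hV, gaussianReal_of_var_ne_zero _ hV,
    ← withDensity_mul _ (measurable_gaussianPDF 0 V) hm]
  congr 1
  ext y
  simp only [Pi.mul_apply, gaussianPDF_def]
  rw [← ENNReal.ofReal_mul (gaussianPDFReal_nonneg _ _ _)]
  congr 1
  rw [gaussianPDFReal_def, gaussianPDFReal_def, sqrtRatio, ← Real.exp_nat_mul]
  beta_reduce
  rw [mul_assoc (√(2 * Real.pi * (V : ℝ)))⁻¹, ← Real.exp_add]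
  congr 2
  field_simp
  push_cast
  ring

lemma integral_sqrtRatio {V : ℝ≥0} (hV : V ≠ 0) (a : ℝ) :
    ∫ y, sqrtRatio V a y ∂(gaussianReal 0 V) = Real.exp (-(a ^ 2 / (8 * V))) := by
  have hV' : (V : ℝ) ≠ 0 := by exact_mod_cast hV
  have h := mgf_gaussianReal (p := gaussianReal 0 V) (μ := 0) (v := V) (X := id) (by simp) (a / (2 * V))
  simp only [mgf, id] at h
  have h1 : ∀ y, sqrtRatio V a y =
      Real.exp (-(a ^ 2 / (4 * V))) * Real.exp (a / (2 * V) * y) := by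
    intro y
    rw [sqrtRatio, ← Real.exp_add]
    congr 1
    ring
  simp_rw [h1]
  rw [integral_const_mul, h, ← Real.exp_add]
  congr 1
  field_simp
  ring

lemma map_prod_add_eq_withDensity {α : Type*} [MeasurableSpace α] {κ : Measure α}
    [IsProbabilityMeasure κ] {V : ℝ≥0} (hV : V ≠ 0) {a : α → ℝ} (ha : Measurable a) :
    (κ.prod (gaussianReal 0 V)).map (fun z => (z.1, a z.1 + z.2)) =
      (κ.prod (gaussianReal 0 V)).withDensity
        fun z => ENNReal.ofReal (sqrtRatio V (a z.1) z.2 ^ 2) := by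
  have hm : Measurable fun z : α × ℝ => ENNReal.ofReal (sqrtRatio V (a z.1) z.2 ^ 2) := by
    unfold sqrtRatio; fun_prop
  ext s hs
  rw [Measure.map_apply (by fun_prop) hs, Measure.prod_apply (by measurability),
    withDensity_apply _ hs, ← lintegral_indicator hs,
    lintegral_prod _ (hm.indicator hs).aemeasurable]
  refine lintegral_congr fun x => ?_
  have h1 : (gaussianReal 0 V).map (fun y => a x + y) = gaussianReal (a x) V := by
    rw [gaussianReal_map_const_add, zero_add]
  have hs' : MeasurableSet (Prod.mk x ⁻¹' s) := measurable_prodMk_left hs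
  have h2 : Prod.mk x ⁻¹' ((fun z : α × ℝ => (z.1, a z.1 + z.2)) ⁻¹' s) =
      (fun y => a x + y) ⁻¹' (Prod.mk x ⁻¹' s) := rfl
  rw [h2, ← Measure.map_apply (by fun_prop) hs', h1, gaussianReal_eq_withDensity_sqrtRatio hV,
    withDensity_apply _ hs', ← lintegral_indicator hs']
  rfl

lemma measurable_sqrtRatio_prod {α : Type*} [MeasurableSpace α] (V : ℝ≥0) {a : α → ℝ}
    (ha : Measurable a) : Measurable fun z : α × ℝ => sqrtRatio V (a z.1) z.2 := by
  unfold sqrtRatio; fun_prop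

lemma isProbabilityMeasure_withDensity_sqrtRatio {α : Type*} [MeasurableSpace α] (κ : Measure α)
    [IsProbabilityMeasure κ] {V : ℝ≥0} (hV : V ≠ 0) {a : α → ℝ} (ha : Measurable a) :
    IsProbabilityMeasure ((κ.prod (gaussianReal 0 V)).withDensity
        fun z => ENNReal.ofReal (sqrtRatio V (a z.1) z.2 ^ 2)) := by
  rw [← map_prod_add_eq_withDensity hV ha]
  exact Measure.isProbabilityMeasure_map (by fun_prop)

lemma integral_prod_sqrtRatio {α : Type*} [MeasurableSpace α] (κ : Measure α)
    [IsProbabilityMeasure κ] {V : ℝ≥0} (hV : V ≠ 0) {a : α → ℝ} (ha : Measurable a) :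
    ∫ z, sqrtRatio V (a z.1) z.2 ∂(κ.prod (gaussianReal 0 V)) =
      ∫ x, Real.exp (-(a x ^ 2 / (8 * V))) ∂κ := by
  have := isProbabilityMeasure_withDensity_sqrtRatio κ hV ha
  rw [integral_prod _ (integrable_of_isFiniteMeasure_withDensity_sq
    (measurable_sqrtRatio_prod V ha))]
  simp_rw [integral_sqrtRatio hV]

lemma integrable_exp_neg_sq_div {α : Type*} [MeasurableSpace α] (κ : Measure α)
    [IsProbabilityMeasure κ] (V : ℝ≥0) {a : α → ℝ} (ha : Measurable a) :
    Integrable (fun x => Real.exp (-(a x ^ 2 / (8 * V)))) κ := by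
  refine Integrable.mono' (integrable_const 1) (by fun_prop)
    (Filter.Eventually.of_forall fun x => ?_)
  rw [Real.norm_eq_abs, abs_of_pos (Real.exp_pos _), Real.exp_le_one_iff]
  have : (0 : ℝ) ≤ a x ^ 2 / (8 * V) := by positivity
  linarith

lemma integral_prod_sqrtRatio_le_one {α : Type*} [MeasurableSpace α] (κ : Measure α)
    [IsProbabilityMeasure κ] {V : ℝ≥0} (hV : V ≠ 0) {a : α → ℝ} (ha : Measurable a) :
    ∫ z, sqrtRatio V (a z.1) z.2 ∂(κ.prod (gaussianReal 0 V)) ≤ 1 := by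
  rw [integral_prod_sqrtRatio κ hV ha]
  calc _ ≤ ∫ _, (1 : ℝ) ∂κ := by
        refine integral_mono (integrable_exp_neg_sq_div κ V ha) (integrable_const 1) fun x => ?_
        simp only [Real.exp_le_one_iff]
        have : (0 : ℝ) ≤ a x ^ 2 / (8 * V) := by positivity
        linarith
    _ = 1 := by simp

lemma one_sub_le_integral_prod_sqrtRatio {α : Type*} [MeasurableSpace α] (κ : Measure α)
    [IsProbabilityMeasure κ] {V : ℝ≥0} (hV : V ≠ 0) {a : α → ℝ} (ha : Measurable a)
    (hint : Integrable (fun x => a x ^ 2) κ) :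
    1 - (∫ x, a x ^ 2 ∂κ) / (8 * V) ≤
      ∫ z, sqrtRatio V (a z.1) z.2 ∂(κ.prod (gaussianReal 0 V)) := by
  rw [integral_prod_sqrtRatio κ hV ha, ← integral_div]
  calc 1 - ∫ x, a x ^ 2 / (8 * V) ∂κ = ∫ x, (1 - a x ^ 2 / (8 * V)) ∂κ := by
        rw [integral_sub (integrable_const 1) (hint.div_const _)]; simp
    _ ≤ _ := by
        refine integral_mono ((integrable_const 1).sub (hint.div_const _))
          (integrable_exp_neg_sq_div κ V ha) fun x => ?_
        have := Real.add_one_le_exp (-(a x ^ 2 / (8 * V)))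
        simp only
        linarith

/-- In a sample of independent pairs `(xᵢ, yᵢ)` with Gaussian `yᵢ`, shifting each `yᵢ` by `aᵢ(xᵢ)`
raises the probability of an event by an amount that depends on `∑ᵢ E[aᵢ(xᵢ)²]` only. -/
lemma measureReal_pi_shift_sub_le {ι : Type*} [Fintype ι] {α : Type*} [MeasurableSpace α]
    (κ : Measure α) [IsProbabilityMeasure κ] {V : ℝ≥0} (hV : V ≠ 0) {a : ι → α → ℝ}
    (ha : ∀ i, Measurable (a i)) (hint : ∀ i, Integrable (fun x => a i x ^ 2) κ)
    {E : Set (ι → α × ℝ)} (hE : MeasurableSet E) {t : ℝ} (ht : 0 < t) :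
    (Measure.pi fun _ : ι => κ.prod (gaussianReal 0 V)).real
        {z | (fun i => ((z i).1, a i (z i).1 + (z i).2)) ∈ E}
      - (Measure.pi fun _ : ι => κ.prod (gaussianReal 0 V)).real E ≤
      (t * ((∑ i, ∫ x, a i x ^ 2 ∂κ) / (8 * V)) + 2 / t) / 2 := by
  have hprob := fun i => isProbabilityMeasure_withDensity_sqrtRatio κ hV (ha i)
  have hshift : Measure.map (fun (z : ι → α × ℝ) i => ((z i).1, a i (z i).1 + (z i).2))
      (Measure.pi fun _ : ι => κ.prod (gaussianReal 0 V)) =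
      (Measure.pi fun _ : ι => κ.prod (gaussianReal 0 V)).withDensity
        fun z => ENNReal.ofReal ((∏ i, sqrtRatio V (a i (z i).1) (z i).2) ^ 2) := by
    rw [← pi_withDensity_sq (fun _ : ι => κ.prod (gaussianReal 0 V))
      (g := fun i z => sqrtRatio V (a i z.1) z.2)
      (fun i => measurable_sqrtRatio_prod V (ha i))]
    simp_rw [← map_prod_add_eq_withDensity hV (ha _)] at hprob ⊢
    rw [← Measure.pi_map_pi (f := fun i (z : α × ℝ) => (z.1, a i z.1 + z.2))
      (fun i => (by fun_prop : Measurable _).aemeasurable)]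
  have hmeas : Measurable fun (z : ι → α × ℝ) i => ((z i).1, a i (z i).1 + (z i).2) := by
    fun_prop
  have hP : IsProbabilityMeasure ((Measure.pi fun _ : ι => κ.prod (gaussianReal 0 V)).withDensity
        fun z => ENNReal.ofReal ((∏ i, sqrtRatio V (a i (z i).1) (z i).2) ^ 2)) := by
    rw [← hshift]
    exact Measure.isProbabilityMeasure_map hmeas.aemeasurable
  have hG : Measurable fun z : ι → α × ℝ => ∏ i, sqrtRatio V (a i (z i).1) (z i).2 :=
    Finset.measurable_prod _ fun i _ =>
      (measurable_sqrtRatio_prod V (ha i)).comp (measurable_pi_apply i)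
  have hmain := measureReal_withDensity_sq_sub_le
    (P := Measure.pi fun _ : ι => κ.prod (gaussianReal 0 V)) hG hE ht
  rw [← hshift, map_measureReal_apply hmeas hE,
    integral_fintype_prod_eq_prod (fun i (z : α × ℝ) => sqrtRatio V (a i z.1) z.2)] at hmain
  refine hmain.trans ?_
  have hprod := one_sub_sum_le_prod Finset.univ
    (fun i => ∫ z, sqrtRatio V (a i z.1) z.2 ∂(κ.prod (gaussianReal 0 V)))
    (fun i => (∫ x, a i x ^ 2 ∂κ) / (8 * V))
    (fun i _ => integral_nonneg fun z => (Real.exp_pos _).le)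
    (fun i _ => integral_prod_sqrtRatio_le_one κ hV (ha i))
    (fun i _ => one_sub_le_integral_prod_sqrtRatio κ hV (ha i) (hint i))
  rw [← Finset.sum_div] at hprod
  gcongr
  linarith

/-! ### Hypercube averaging -/

open Classical in
/-- Number of the tests `E j`, `j ∈ S`, that give the wrong answer at the observation `x` when the
vertex of the hypercube is `b`; the test `E j` decides for `j ∈ b` on the set `E j`. -/
noncomputable def errorCount {ι 𝒳 : Type*} (S : Finset ι) (E : ι → Set 𝒳) (b : Finset ι)
    (x : 𝒳) : ℕ :=
  (S.filter fun j => ¬(x ∈ E j ↔ j ∈ b)).card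

/-- The set on which the test `E j` errs at the vertex `b`. -/
def errorSet {ι 𝒳 : Type*} (E : ι → Set 𝒳) (b : Finset ι) (j : ι) : Set 𝒳 :=
  {x | ¬(x ∈ E j ↔ j ∈ b)}

lemma measurableSet_errorSet {ι 𝒳 : Type*} [MeasurableSpace 𝒳] {E : ι → Set 𝒳} {j : ι}
    (hE : MeasurableSet (E j)) (b : Finset ι) : MeasurableSet (errorSet E b j) := by
  by_cases hj : j ∈ b
  · convert hE.compl using 1; ext x; simp [errorSet, hj]
  · convert hE using 1; ext x; simp [errorSet, hj]

lemma errorCount_eq_sum {ι 𝒳 : Type*} (S : Finset ι) (E : ι → Set 𝒳) (b : Finset ι) (x : 𝒳) :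
    (errorCount S E b x : ℝ) = ∑ j ∈ S, (errorSet E b j).indicator (fun _ => (1 : ℝ)) x := by
  classical
  simp only [errorCount, errorSet, Set.indicator_apply, Finset.card_filter, Set.mem_ofPred_eq]
  push_cast
  exact Finset.sum_congr rfl fun j _ => by congr

/-- A single test, averaged over the hypercube: the vertices are paired along the direction `j`, and
over each pair the two error probabilities add up to at least `3/4`. -/
lemma three_eighths_mul_le_sum_errorSet {ι 𝒳 : Type*} [MeasurableSpace 𝒳] {S : Finset ι}
    (P : Finset ι → Measure 𝒳) [∀ b, IsProbabilityMeasure (P b)] {E : ι → Set 𝒳}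
    {j : ι} (hj : j ∈ S) (hE : MeasurableSet (E j))
    (hP : ∀ b ⊆ S, j ∉ b → ∀ b', (∀ i, i ∈ b' ↔ i = j ∨ i ∈ b) →
      (P b').real (E j) - (P b).real (E j) ≤ 1 / 4) :
    3 / 8 * (2 : ℝ) ^ S.card ≤ ∑ b ∈ S.powerset, (P b).real (errorSet E b j) := by
  classical
  obtain ⟨T, hjT, rfl⟩ : ∃ T, j ∉ T ∧ S = insert j T :=
    ⟨S.erase j, Finset.notMem_erase j S, (Finset.insert_erase hj).symm⟩
  rw [Finset.sum_powerset_insert hjT, ← Finset.sum_add_distrib, Finset.card_insert_of_notMem hjT,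
    pow_succ]
  have hterm : ∀ b ∈ T.powerset, (3 / 4 : ℝ) ≤
      (P b).real (errorSet E b j) + (P (insert j b)).real (errorSet E (insert j b) j) := by
    intro b hb
    rw [Finset.mem_powerset] at hb
    have hjb : j ∉ b := fun h => hjT (hb h)
    have h1 : errorSet E b j = E j := by ext x; simp [errorSet, hjb]
    have h2 : errorSet E (insert j b) j = (E j)ᶜ := by ext x; simp [errorSet]
    rw [h1, h2, probReal_compl_eq_one_sub hE]
    have := hP b (hb.trans (Finset.subset_insert j T)) hjb (insert j b) (by simp)
    linarith
  have := Finset.card_nsmul_le_sum _ _ _ hterm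
  rw [Finset.card_powerset, nsmul_eq_mul] at this
  push_cast at this
  linarith

/-- Assouad's argument, in probability. If no test of a coordinate separates neighbouring vertices
of the hypercube well, then at some vertex an eighth of the tests err with probability `1/4`: on
average over the vertices the expected number of errors is at least `3/8` of the number of tests,
and the number of errors never exceeds that number. -/
lemma exists_vertex_errorCount {ι 𝒳 : Type*} [MeasurableSpace 𝒳] (S : Finset ι)
    (P : Finset ι → Measure 𝒳) [∀ b, IsProbabilityMeasure (P b)] {E : ι → Set 𝒳}
    (hE : ∀ j ∈ S, MeasurableSet (E j))
    (hP : ∀ j ∈ S, ∀ b ⊆ S, j ∉ b → ∀ b', (∀ i, i ∈ b' ↔ i = j ∨ i ∈ b) →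
      (P b').real (E j) - (P b).real (E j) ≤ 1 / 4) :
    ∃ b ⊆ S, 1 / 4 ≤ (P b).real {x | (S.card : ℝ) / 8 ≤ errorCount S E b x} := by
  by_contra! hcon
  have hd : (0 : ℝ) < S.card := by
    rw [Nat.cast_pos, Finset.card_pos, Finset.nonempty_iff_ne_empty]
    rintro rfl
    have := hcon ∅ (Finset.empty_subset _)
    simp [errorCount] at this
    norm_num at this
  have hmean : ∀ b ∈ S.powerset,
      ∑ j ∈ S, (P b).real (errorSet E b j) < 3 / 8 * S.card := by
    intro b hb
    have hb' := hcon b (Finset.mem_powerset.1 hb)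
    set B : Set 𝒳 := {x | (S.card : ℝ) / 8 ≤ errorCount S E b x} with hB
    have hind : ∀ j ∈ S, Integrable ((errorSet E b j).indicator fun _ => (1 : ℝ)) (P b) :=
      fun j hj => (integrable_const 1).indicator (measurableSet_errorSet (hE j hj) b)
    have hmeasB : MeasurableSet B := by
      have : Measurable fun x => (errorCount S E b x : ℝ) := by
        simp_rw [errorCount_eq_sum]
        exact Finset.measurable_sum _ fun j hj =>
          measurable_const.indicator (measurableSet_errorSet (hE j hj) b)
      exact measurableSet_le measurable_const this
    have hsum : ∑ j ∈ S, (P b).real (errorSet E b j) = ∫ x, (errorCount S E b x : ℝ) ∂(P b) := by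
      simp_rw [errorCount_eq_sum]
      rw [integral_finsetSum _ hind]
      refine Finset.sum_congr rfl fun j hj => ?_
      rw [integral_indicator (measurableSet_errorSet (hE j hj) b)]
      simp
    rw [hsum]
    calc ∫ x, (errorCount S E b x : ℝ) ∂(P b)
        ≤ ∫ x, ((S.card : ℝ) / 8 + B.indicator (fun _ => (S.card : ℝ)) x) ∂(P b) := by
          refine integral_mono ?_ ?_ fun x => ?_
          · simp_rw [errorCount_eq_sum]
            exact integrable_finsetSum _ hind
          · exact (integrable_const _).add ((integrable_const _).indicator hmeasB)
          · by_cases hx : x ∈ B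
            · have : (errorCount S E b x : ℝ) ≤ S.card := by
                classical exact_mod_cast Finset.card_filter_le S _
              simp only [Set.indicator_of_mem hx]
              linarith
            · simp only [Set.indicator_of_notMem hx, add_zero]
              exact (not_le.1 hx).le
      _ = S.card / 8 + S.card * (P b).real B := by
          rw [integral_add (integrable_const _) ((integrable_const _).indicator hmeasB),
            integral_indicator hmeasB]
          simp [mul_comm]
      _ < 3 / 8 * S.card := by nlinarith
  have hlt : ∑ b ∈ S.powerset, ∑ j ∈ S, (P b).real (errorSet E b j) <
      ∑ _b ∈ S.powerset, 3 / 8 * (S.card : ℝ) :=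
    Finset.sum_lt_sum_of_nonempty ⟨∅, Finset.empty_mem_powerset S⟩ hmean
  rw [Finset.sum_comm, Finset.sum_const, Finset.card_powerset, nsmul_eq_mul] at hlt
  have hge := Finset.card_nsmul_le_sum S _ _ fun j hj =>
    three_eighths_mul_le_sum_errorSet P hj (hE j hj) (hP j hj)
  rw [nsmul_eq_mul] at hge
  push_cast at hlt
  linarith

/-! ### Singular values -/

lemma sum_sq_singularValues {m₁ m₂ : ℕ} (A : Matrix (Fin m₁) (Fin m₂) ℝ) :
    ∑ l ∈ Finset.range m₂, (Matrix.toEuclideanLin A).singularValues l ^ 2 = frobNorm A ^ 2 := by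
  set T := Matrix.toEuclideanLin A with hT
  have hn : Module.finrank ℝ (EuclideanSpace ℝ (Fin m₂)) = m₂ := by simp
  have h1 : ∑ l ∈ Finset.range m₂, T.singularValues l ^ 2 =
      LinearMap.trace ℝ _ (LinearMap.adjoint T ∘ₗ T) := by
    rw [T.isSymmetric_adjoint_comp_self.trace_eq_sum_eigenvalues hn, Finset.sum_range]
    simp only [RCLike.ofReal_real_eq_id, id]
    exact Finset.sum_congr rfl fun i _ => T.sq_singularValues_fin hn i
  rw [h1, LinearMap.trace_eq_sum_inner _ (EuclideanSpace.basisFun (Fin m₂) ℝ), frobNorm,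
    Real.sq_sqrt (by positivity), Finset.sum_comm]
  refine Finset.sum_congr rfl fun j _ => ?_
  rw [LinearMap.comp_apply, LinearMap.adjoint_inner_right, real_inner_self_eq_norm_sq,
    EuclideanSpace.real_norm_sq_eq]
  simp [hT]

/-- A matrix of rank at most `s` has at most `s` nonzero singular values, whence the bound
`‖A‖_* ≤ √s ‖A‖_F`, here in squared form. -/
lemma nuclearNorm_sq_le {m₁ m₂ s : ℕ} {A : Matrix (Fin m₁) (Fin m₂) ℝ} (hA : A.rank ≤ s) :
    nuclearNorm A ^ 2 ≤ s * frobNorm A ^ 2 := by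
  set T := Matrix.toEuclideanLin A with hT
  have hrank : Module.finrank ℝ T.range = A.rank := by
    rw [hT, Matrix.toEuclideanLin_eq_toLin_orthonormal, ← Matrix.rank_eq_finrank_range_toLin]
  have hzero : ∀ l, A.rank ≤ l → T.singularValues l = 0 := fun l hl =>
    T.singularValues_eq_zero_iff_le_finrank_range.2 (hrank.trans_le hl)
  have hr : A.rank ≤ min m₁ m₂ := le_min (by simpa using A.rank_le_height)
    (by simpa using A.rank_le_width)
  have h1 : nuclearNorm A = ∑ l ∈ Finset.range A.rank, T.singularValues l := by
    refine (Finset.sum_subset (Finset.range_subset_range.2 hr) fun l _ hl => hzero l ?_).symm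
    simpa using hl
  have h2 : ∑ l ∈ Finset.range A.rank, T.singularValues l ^ 2 = frobNorm A ^ 2 := by
    rw [← sum_sq_singularValues]
    refine Finset.sum_subset (Finset.range_subset_range.2 (hr.trans (min_le_right _ _)))
      fun l _ hl => ?_
    rw [hzero l (by simpa using hl)]
    simp
  rw [h1]
  refine sq_sum_le_card_mul_sum_sq.trans ?_
  rw [h2, Finset.card_range]
  gcongr

lemma nuclearNorm_zero (m₁ m₂ : ℕ) : nuclearNorm (0 : Matrix (Fin m₁) (Fin m₂) ℝ) = 0 := by
  simp [nuclearNorm]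

lemma frobNorm_sq {m₁ m₂ : ℕ} (A : Matrix (Fin m₁) (Fin m₂) ℝ) :
    frobNorm A ^ 2 = ∑ i, ∑ j, A i j ^ 2 :=
  Real.sq_sqrt (by positivity)

/-! ### The sampling model -/

lemma frobInner_eq_sum {m₁ m₂ : ℕ} (A B : Matrix (Fin m₁) (Fin m₂) ℝ) :
    frobInner A B = ∑ l, ∑ j, A j l * B j l := by
  simp [frobInner, Matrix.trace, Matrix.mul_apply]

lemma frobInner_add_right {m₁ m₂ : ℕ} (A B D : Matrix (Fin m₁) (Fin m₂) ℝ) :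
    frobInner A (B + D) = frobInner A B + frobInner A D := by
  simp [frobInner, Matrix.mul_add]

lemma frobInner_single {m₁ m₂ : ℕ} (j : Fin m₁) (l : Fin m₂) (D : Matrix (Fin m₁) (Fin m₂) ℝ) :
    frobInner (Matrix.single j l 1) D = D j l := by
  rw [frobInner, Matrix.transpose_single, Matrix.trace_single_mul, one_smul]

lemma measurable_entry {m₁ m₂ : ℕ} (j : Fin m₁) (l : Fin m₂) :
    Measurable fun A : Matrix (Fin m₁) (Fin m₂) ℝ => A j l :=
  Measurable.comp (g := fun r : Fin m₂ → ℝ => r l)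
    (f := fun A : Fin m₁ → Fin m₂ → ℝ => A j) (measurable_pi_apply l) (measurable_pi_apply j)

lemma measurable_frobInner_left {m₁ m₂ : ℕ} (B : Matrix (Fin m₁) (Fin m₂) ℝ) :
    Measurable fun A => frobInner A B := by
  simp_rw [frobInner_eq_sum]
  exact Finset.measurable_sum _ fun l _ => Finset.measurable_sum _ fun j _ =>
    (measurable_entry j l).mul_const _

lemma isProbabilityMeasure_uniformSampling {m₁ m₂ : ℕ} (h₁ : 0 < m₁) (h₂ : 0 < m₂) :
    IsProbabilityMeasure (uniformSampling m₁ m₂) := by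
  constructor
  simp only [uniformSampling, Measure.finsetSum_apply, Measure.smul_apply, measure_univ,
    smul_eq_mul, mul_one, Finset.sum_const, Finset.card_univ, Fintype.card_fin, nsmul_eq_mul]
  rw [← mul_assoc]
  refine ENNReal.mul_inv_cancel ?_ ?_
  · simp [h₁.ne', h₂.ne']
  · exact ENNReal.mul_ne_top (ENNReal.natCast_ne_top _) (ENNReal.natCast_ne_top _)

lemma integrable_smul_dirac {α : Type*} [MeasurableSpace α] {f : α → ℝ} (hf : Measurable f)
    {c : ℝ≥0∞} (hc : c ≠ ∞) (x : α) : Integrable f (c • Measure.dirac x) :=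
  (integrable_dirac' hf.stronglyMeasurable (by simp)).smul_measure hc

lemma inv_card_ne_top {m₁ m₂ : ℕ} (h₁ : 0 < m₁) (h₂ : 0 < m₂) :
    ((m₁ : ℝ≥0∞) * (m₂ : ℝ≥0∞))⁻¹ ≠ ∞ := by
  simp [h₁.ne', h₂.ne']

lemma integrable_uniformSampling {m₁ m₂ : ℕ} (h₁ : 0 < m₁) (h₂ : 0 < m₂)
    {f : Matrix (Fin m₁) (Fin m₂) ℝ → ℝ} (hf : Measurable f) :
    Integrable f (uniformSampling m₁ m₂) := by
  refine integrable_finsetSum_measure.2 fun j _ => integrable_finsetSum_measure.2 fun l _ => ?_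
  exact integrable_smul_dirac hf (inv_card_ne_top h₁ h₂) _

lemma integral_uniformSampling {m₁ m₂ : ℕ} (h₁ : 0 < m₁) (h₂ : 0 < m₂)
    {f : Matrix (Fin m₁) (Fin m₂) ℝ → ℝ} (hf : Measurable f) :
    ∫ x, f x ∂(uniformSampling m₁ m₂) =
      (∑ j, ∑ l, f (Matrix.single j l 1)) / ((m₁ : ℝ) * m₂) := by
  have hi := fun (j : Fin m₁) (l : Fin m₂) =>
    integrable_smul_dirac hf (inv_card_ne_top h₁ h₂) (Matrix.single j l (1 : ℝ))
  rw [uniformSampling, integral_finsetSum_measure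
    (fun j _ => integrable_finsetSum_measure.2 fun l _ => hi j l), Finset.sum_div]
  refine Finset.sum_congr rfl fun j _ => ?_
  rw [integral_finsetSum_measure (fun l _ => hi j l), Finset.sum_div]
  refine Finset.sum_congr rfl fun l _ => ?_
  rw [integral_smul_measure, integral_dirac' _ _ hf.stronglyMeasurable]
  simp [div_eq_inv_mul, mul_comm]

lemma integral_frobInner_sq {m₁ m₂ : ℕ} (h₁ : 0 < m₁) (h₂ : 0 < m₂)
    (D : Matrix (Fin m₁) (Fin m₂) ℝ) :
    ∫ x, frobInner x D ^ 2 ∂(uniformSampling m₁ m₂) = frobNorm D ^ 2 / ((m₁ : ℝ) * m₂) := by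
  rw [integral_uniformSampling h₁ h₂ ((measurable_frobInner_left D).pow_const 2), frobNorm_sq]
  simp_rw [frobInner_single]

/-- The joint law of all the pairs (sampling matrix, noise), with noise variance `V`. -/
noncomputable def noiseLaw (m₁ m₂ : ℕ) {K : ℕ} (n : Fin (K + 1) → ℕ) (V : ℝ≥0) :
    Measure ((_ : (k : Fin (K + 1)) × Fin (n k)) → Matrix (Fin m₁) (Fin m₂) ℝ × ℝ) :=
  Measure.pi fun _ => (uniformSampling m₁ m₂).prod (gaussianReal 0 V)

/-- The data as a function of the realised pairs (sampling matrix, noise). -/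
def dataOf {m₁ m₂ K : ℕ} {n : Fin (K + 1) → ℕ} (A : Fin (K + 1) → Matrix (Fin m₁) (Fin m₂) ℝ)
    (z : (_ : (k : Fin (K + 1)) × Fin (n k)) → Matrix (Fin m₁) (Fin m₂) ℝ × ℝ) :
    DataSpace m₁ m₂ K n :=
  fun k i => ((z ⟨k, i⟩).1, frobInner (z ⟨k, i⟩).1 (A k) + (z ⟨k, i⟩).2)

lemma measurable_dataOf {m₁ m₂ K : ℕ} {n : Fin (K + 1) → ℕ}
    (A : Fin (K + 1) → Matrix (Fin m₁) (Fin m₂) ℝ) : Measurable (dataOf (n := n) A) := by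
  refine measurable_pi_lambda _ fun k => measurable_pi_lambda _ fun i => ?_
  have hz : Measurable fun z : (_ : (k : Fin (K + 1)) × Fin (n k)) →
      Matrix (Fin m₁) (Fin m₂) ℝ × ℝ => z ⟨k, i⟩ := measurable_pi_apply _
  exact hz.fst.prodMk (((measurable_frobInner_left (A k)).comp hz.fst).add hz.snd)

/-- The laws of the data under two families of parameters are close as soon as the squared Frobenius
distances, weighted by the sample sizes, are small compared with `V m₁ m₂`. -/
lemma measureReal_dataOf_sub_le {m₁ m₂ K : ℕ} {n : Fin (K + 1) → ℕ} (h₁ : 0 < m₁) (h₂ : 0 < m₂)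
    {V : ℝ≥0} (hV : V ≠ 0) (A A' : Fin (K + 1) → Matrix (Fin m₁) (Fin m₂) ℝ)
    {F : Set (DataSpace m₁ m₂ K n)} (hF : MeasurableSet F) {t : ℝ} (ht : 0 < t) :
    ((noiseLaw m₁ m₂ n V).map (dataOf A')).real F - ((noiseLaw m₁ m₂ n V).map (dataOf A)).real F ≤
      (t * ((∑ k, n k * frobNorm (A' k - A k) ^ 2) / ((m₁ : ℝ) * m₂) / (8 * V)) + 2 / t) / 2 := by
  have := isProbabilityMeasure_uniformSampling h₁ h₂
  have h := measureReal_pi_shift_sub_le (uniformSampling m₁ m₂) hV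
    (a := fun (p : (k : Fin (K + 1)) × Fin (n k)) x => frobInner x (A' p.1 - A p.1))
    (fun p => measurable_frobInner_left _)
    (fun p => integrable_uniformSampling h₁ h₂ ((measurable_frobInner_left _).pow_const 2))
    (measurable_dataOf A hF) ht
  rw [map_measureReal_apply (measurable_dataOf A') hF,
    map_measureReal_apply (measurable_dataOf A) hF]
  have hset : dataOf (n := n) A' ⁻¹' F =
      {z | (fun p : (k : Fin (K + 1)) × Fin (n k) =>
        ((z p).1, frobInner (z p).1 (A' p.1 - A p.1) + (z p).2)) ∈ dataOf A ⁻¹' F} := by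
    ext z
    simp only [Set.mem_preimage, Set.mem_ofPred_eq]
    suffices dataOf A' z = dataOf A (fun p : (k : Fin (K + 1)) × Fin (n k) =>
        ((z p).1, frobInner (z p).1 (A' p.1 - A p.1) + (z p).2)) by rw [this]
    funext k i
    simp only [dataOf]
    rw [← add_assoc, ← frobInner_add_right, add_sub_cancel]
  rw [hset]
  refine h.trans (le_of_eq ?_)
  simp_rw [integral_frobInner_sq h₁ h₂]
  rw [Fintype.sum_sigma, Finset.sum_div (a := (m₁ : ℝ) * m₂)]
  simp only [Finset.sum_const, Finset.card_univ, Fintype.card_fin, nsmul_eq_mul, mul_div_assoc]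

lemma hasLaw_noiseLaw {m₁ m₂ K : ℕ} {n : Fin (K + 1) → ℕ} (h₁ : 0 < m₁) (h₂ : 0 < m₂)
    {V : ℝ≥0} {Ω : Type*} [MeasurableSpace Ω] {μ : Measure Ω} [IsProbabilityMeasure μ]
    {X : (k : Fin (K + 1)) → Fin (n k) → Ω → Matrix (Fin m₁) (Fin m₂) ℝ}
    {ξ : (k : Fin (K + 1)) → Fin (n k) → Ω → ℝ}
    (hX : ∀ k i, HasLaw (X k i) (uniformSampling m₁ m₂) μ)
    (hξ : ∀ k i, HasLaw (ξ k i) (gaussianReal 0 V) μ)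
    (hXξ : ∀ k i, IndepFun (X k i) (ξ k i) μ)
    (hind : iIndepFun (fun (p : (k : Fin (K + 1)) × Fin (n k)) (ω : Ω) =>
      (X p.1 p.2 ω, ξ p.1 p.2 ω)) μ) :
    HasLaw (fun ω (p : (k : Fin (K + 1)) × Fin (n k)) => (X p.1 p.2 ω, ξ p.1 p.2 ω))
      (noiseLaw m₁ m₂ n V) μ := by
  have := isProbabilityMeasure_uniformSampling h₁ h₂
  exact iIndepFun.hasLaw_pi (fun p => (hXξ p.1 p.2).hasLaw_prod (hX p.1 p.2) (hξ p.1 p.2)) hind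

/-! ### Hypercubes of matrices -/

/-- The vertex `b` of a hypercube of matrices: entries `δ` at the positions in `b`, and `0`
elsewhere. -/
def cubeMatrix {m₁ m₂ : ℕ} (δ : ℝ) (b : Finset (Fin m₁ × Fin m₂)) :
    Matrix (Fin m₁) (Fin m₂) ℝ :=
  fun j l => if (j, l) ∈ b then δ else 0

/-- The family of parameters equal to `cubeMatrix δ b` for the data sets in `I`, and to `0` for the
others, which therefore carry no information on `b`. -/
def cubeParam {m₁ m₂ K : ℕ} (I : Finset (Fin (K + 1))) (δ : ℝ) (b : Finset (Fin m₁ × Fin m₂)) :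
    Fin (K + 1) → Matrix (Fin m₁) (Fin m₂) ℝ :=
  fun k => if k ∈ I then cubeMatrix δ b else 0

lemma frobNorm_sq_eq_sum_prod {m₁ m₂ : ℕ} (A : Matrix (Fin m₁) (Fin m₂) ℝ) :
    frobNorm A ^ 2 = ∑ p : Fin m₁ × Fin m₂, A p.1 p.2 ^ 2 := by
  rw [frobNorm_sq, Fintype.sum_prod_type]

lemma frobNorm_cubeMatrix_sq {m₁ m₂ : ℕ} (δ : ℝ) (b : Finset (Fin m₁ × Fin m₂)) :
    frobNorm (cubeMatrix δ b) ^ 2 = b.card * δ ^ 2 := by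
  simp [frobNorm_sq_eq_sum_prod, cubeMatrix, ite_pow]

lemma frobNorm_cubeMatrix_sub_sq {m₁ m₂ : ℕ} (δ : ℝ) {b b' : Finset (Fin m₁ × Fin m₂)}
    {j : Fin m₁ × Fin m₂} (hj : j ∉ b) (hb' : ∀ i, i ∈ b' ↔ i = j ∨ i ∈ b) :
    frobNorm (cubeMatrix δ b' - cubeMatrix δ b) ^ 2 = δ ^ 2 := by
  rw [frobNorm_sq_eq_sum_prod, Finset.sum_eq_single j]
  · simp [cubeMatrix, hb', hj]
  · intro p _ hp
    simp [cubeMatrix, hb', hp]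
  · simp

lemma errorCount_mul_le_frobNorm_sq {m₁ m₂ : ℕ} {𝒳 : Type*} {δ : ℝ} (hδ : 0 ≤ δ)
    (S b : Finset (Fin m₁ × Fin m₂)) (f : 𝒳 → Matrix (Fin m₁) (Fin m₂) ℝ) (x : 𝒳) :
    errorCount S (fun j => {x | δ / 2 ≤ f x j.1 j.2}) b x * (δ ^ 2 / 4) ≤
      frobNorm (f x - cubeMatrix δ b) ^ 2 := by
  rw [frobNorm_sq_eq_sum_prod, errorCount_eq_sum, Finset.sum_mul]
  refine (Finset.sum_le_sum fun p _ => ?_).trans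
    (Finset.sum_le_sum_of_subset_of_nonneg (Finset.subset_univ S) fun _ _ _ => sq_nonneg _)
  by_cases hp : x ∈ errorSet (fun j : Fin m₁ × Fin m₂ => {x | δ / 2 ≤ f x j.1 j.2}) b p
  · rw [Set.indicator_of_mem hp]
    simp only [errorSet, Set.mem_ofPred_eq] at hp
    by_cases hpb : p ∈ b
    · have : f x p.1 p.2 < δ / 2 := by simpa [hpb] using hp
      simp only [Matrix.sub_apply, cubeMatrix, Prod.mk.eta, hpb, if_true]
      nlinarith
    · have : δ / 2 ≤ f x p.1 p.2 := by simpa [hpb] using hp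
      simp only [Matrix.sub_apply, cubeMatrix, Prod.mk.eta, hpb, if_false]
      nlinarith
  · rw [Set.indicator_of_notMem hp, zero_mul]
    positivity

/-- No estimator recovers the vertices of a hypercube of matrices if the side `δ` of the cube is
below the noise level of the informative data sets `I`. -/
lemma exists_vertex_le_frobNorm_sq {m₁ m₂ K : ℕ} {n : Fin (K + 1) → ℕ} (h₁ : 0 < m₁)
    (h₂ : 0 < m₂) {V : ℝ≥0} (hV : V ≠ 0) (S : Finset (Fin m₁ × Fin m₂))
    (I : Finset (Fin (K + 1))) {δ : ℝ} (hδ : 0 ≤ δ)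
    (hI : (∑ k ∈ I, (n k : ℝ)) * δ ^ 2 ≤ V * ((m₁ : ℝ) * m₂) / 4)
    {f : DataSpace m₁ m₂ K n → Matrix (Fin m₁) (Fin m₂) ℝ} (hf : Measurable f) :
    ∃ b ⊆ S, 1 / 4 ≤ ((noiseLaw m₁ m₂ n V).map (dataOf (cubeParam I δ b))).real
      {x | S.card * δ ^ 2 / 32 ≤ frobNorm (f x - cubeMatrix δ b) ^ 2} := by
  have := isProbabilityMeasure_uniformSampling h₁ h₂
  have : IsProbabilityMeasure (noiseLaw m₁ m₂ n V) := by unfold noiseLaw; infer_instance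
  have hprob : ∀ b, IsProbabilityMeasure
      ((noiseLaw m₁ m₂ n V).map (dataOf (cubeParam I δ b))) := fun b =>
    Measure.isProbabilityMeasure_map (measurable_dataOf _).aemeasurable
  have hE : ∀ j ∈ S, MeasurableSet {x | δ / 2 ≤ f x j.1 j.2} := fun j _ =>
    measurableSet_le measurable_const ((measurable_entry j.1 j.2).comp hf)
  obtain ⟨b, hb, hb4⟩ := exists_vertex_errorCount S
    (fun b => (noiseLaw m₁ m₂ n V).map (dataOf (cubeParam I δ b))) hE (by
      intro j hj b _ hjb b' hb'
      -- The value `t = 8` balances the two terms of the bound.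
      refine (measureReal_dataOf_sub_le h₁ h₂ hV _ _ (hE j hj) (t := 8) (by norm_num)).trans ?_
      have hsum : ∑ k, n k * frobNorm (cubeParam I δ b' k - cubeParam I δ b k) ^ 2 =
          (∑ k ∈ I, (n k : ℝ)) * δ ^ 2 := by
        have : ∀ k, n k * frobNorm (cubeParam I δ b' k - cubeParam I δ b k) ^ 2 =
            if k ∈ I then n k * δ ^ 2 else 0 := by
          intro k
          by_cases hk : k ∈ I
          · simp [cubeParam, hk, frobNorm_cubeMatrix_sub_sq δ hjb hb']
          · simp [cubeParam, hk, frobNorm_sq]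
        simp_rw [this]
        rw [Finset.sum_ite_mem, Finset.univ_inter, Finset.sum_mul]
      rw [hsum]
      have hV' : (0 : ℝ) < V := by exact_mod_cast pos_iff_ne_zero.2 hV
      have hm : (0 : ℝ) < (m₁ : ℝ) * m₂ := by positivity
      have : (∑ k ∈ I, (n k : ℝ)) * δ ^ 2 / ((m₁ : ℝ) * m₂) / (8 * V) ≤ 1 / 32 := by
        rw [div_div, div_le_iff₀ (by positivity)]
        linarith
      linarith)
  refine ⟨b, hb, hb4.trans (measureReal_mono fun x hx => ?_)⟩
  have hx' : (S.card : ℝ) / 8 ≤ errorCount S (fun j => {x | δ / 2 ≤ f x j.1 j.2}) b x := hx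
  have h := errorCount_mul_le_frobNorm_sq hδ S b f x
  have h' := mul_le_mul_of_nonneg_right hx' (by positivity : 0 ≤ δ ^ 2 / 4)
  simp only [Set.mem_ofPred_eq]
  linarith

lemma rank_le_card_of_col_support {m₁ m₂ : ℕ} {A : Matrix (Fin m₁) (Fin m₂) ℝ}
    {T : Finset (Fin m₂)} (hA : ∀ j l, l ∉ T → A j l = 0) : A.rank ≤ T.card := by
  have h : A = A * Matrix.diagonal fun l => if l ∈ T then (1 : ℝ) else 0 := by
    ext j l
    by_cases hl : l ∈ T <;> simp [Matrix.mul_diagonal, hl, hA]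
  rw [h]
  refine (Matrix.rank_mul_le_right _ _).trans ?_
  rw [Matrix.rank_diagonal]
  simp

/-- `s` full lines in the long direction: a set of positions of size `s · max m₁ m₂` that supports
matrices of rank at most `s` only. -/
lemma exists_support_rank_le {m₁ m₂ s : ℕ} (hs : s ≤ min m₁ m₂) :
    ∃ S : Finset (Fin m₁ × Fin m₂), S.card = s * max m₁ m₂ ∧
      ∀ δ : ℝ, ∀ b ⊆ S, (cubeMatrix δ b).rank ≤ s := by
  rcases le_total m₂ m₁ with h | h
  · obtain ⟨T, -, hT⟩ := Finset.exists_subset_card_eq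
      (s := (Finset.univ : Finset (Fin m₂))) (n := s) (by simpa using hs.trans (min_le_right _ _))
    refine ⟨Finset.univ ×ˢ T, by simp [hT, max_eq_left h, mul_comm], fun δ b hb => ?_⟩
    rw [← hT]
    refine rank_le_card_of_col_support fun j l hl => ?_
    have : (j, l) ∉ b := fun hm => hl (Finset.mem_product.1 (hb hm)).2
    simp [cubeMatrix, this]
  · obtain ⟨T, -, hT⟩ := Finset.exists_subset_card_eq
      (s := (Finset.univ : Finset (Fin m₁))) (n := s) (by simpa using hs.trans (min_le_left _ _))
    refine ⟨T ×ˢ Finset.univ, by simp [hT, max_eq_right h], fun δ b hb => ?_⟩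
    rw [← hT, ← Matrix.rank_transpose]
    refine rank_le_card_of_col_support fun j l hl => ?_
    have : (l, j) ∉ b := fun hm => hl (Finset.mem_product.1 (hb hm)).1
    simp [cubeMatrix, this]

lemma frobNorm_neg {m₁ m₂ : ℕ} (A : Matrix (Fin m₁) (Fin m₂) ℝ) : frobNorm (-A) = frobNorm A := by
  simp [frobNorm]

lemma rank_neg {m₁ m₂ : ℕ} (A : Matrix (Fin m₁) (Fin m₂) ℝ) : (-A).rank = A.rank := by
  have h : ∀ B : Matrix (Fin m₁) (Fin m₂) ℝ, (-B).rank ≤ B.rank := fun B => by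
    simpa using Matrix.rank_mul_le_right (-1 : Matrix (Fin m₁) (Fin m₁) ℝ) B
  exact (h A).antisymm (by simpa using h (-A))

lemma cubeParam_mem_paramSpace {m₁ m₂ K r s : ℕ} {h δ : ℝ} (hh : 0 ≤ h)
    {I : Finset (Fin (K + 1))} (hI0 : 0 ∈ I) (hsr : s ≤ r) {b : Finset (Fin m₁ × Fin m₂)}
    (hrank : (cubeMatrix δ b).rank ≤ s)
    (hI : I = Finset.univ ∨ (s : ℝ) * (b.card * δ ^ 2) ≤ h ^ 2) :
    cubeParam I δ b ∈ paramSpace m₁ m₂ K r h := by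
  refine ⟨by simpa [cubeParam, hI0] using hrank.trans hsr, fun k => ?_⟩
  by_cases hk : k.succ ∈ I
  · simpa [cubeParam, hI0, hk, nuclearNorm_zero] using hh
  · rcases hI with rfl | hI
    · simp at hk
    · simp only [cubeParam, hI0, hk, if_true, if_false, zero_sub]
      refine abs_le_of_sq_le_sq' ?_ hh |>.2
      have := nuclearNorm_sq_le (s := s) (A := -cubeMatrix δ b) (by rwa [rank_neg])
      rw [frobNorm_neg, frobNorm_cubeMatrix_sq] at this
      exact this.trans hI

lemma exists_mem_paramSpace_le_frobNorm_sq {m₁ m₂ K r s : ℕ} {n : Fin (K + 1) → ℕ} {v h δ : ℝ}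
    (h₁ : 0 < m₁) (h₂ : 0 < m₂) (hr : r ≤ min m₁ m₂) (hv : 0 < v) (hh : 0 ≤ h) (hδ : 0 ≤ δ)
    (hsr : s ≤ r)
    (hcase : ((∑ k, n k : ℕ) : ℝ) * δ ^ 2 ≤ v ^ 2 * ((m₁ : ℝ) * m₂) / 4 ∨
      (n 0 * δ ^ 2 ≤ v ^ 2 * ((m₁ : ℝ) * m₂) / 4 ∧
        (s : ℝ) * (s * (max m₁ m₂ : ℕ) * δ ^ 2) ≤ h ^ 2))
    {Ω : Type*} [MeasurableSpace Ω] {μ : Measure Ω}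
    {X : (k : Fin (K + 1)) → Fin (n k) → Ω → Matrix (Fin m₁) (Fin m₂) ℝ}
    {ξ : (k : Fin (K + 1)) → Fin (n k) → Ω → ℝ}
    (hlaw : HasLaw (fun ω (p : (k : Fin (K + 1)) × Fin (n k)) => (X p.1 p.2 ω, ξ p.1 p.2 ω))
      (noiseLaw m₁ m₂ n (Real.toNNReal (v ^ 2))) μ)
    {f : DataSpace m₁ m₂ K n → Matrix (Fin m₁) (Fin m₂) ℝ} (hf : Measurable f) :
    ∃ A ∈ paramSpace m₁ m₂ K r h, (1 / 4 : ℝ≥0∞) ≤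
      μ {ω | s * (max m₁ m₂ : ℕ) * δ ^ 2 / 32 ≤
        frobNorm (f (observations X ξ A ω) - A 0) ^ 2} := by
  have hV : Real.toNNReal (v ^ 2) ≠ 0 := by
    simpa [Real.toNNReal_eq_zero] using hv.ne'
  have hVv : ((Real.toNNReal (v ^ 2) : ℝ≥0) : ℝ) = v ^ 2 := Real.coe_toNNReal _ (sq_nonneg v)
  obtain ⟨S, hS, hrank⟩ := exists_support_rank_le (hsr.trans hr)
  obtain ⟨I, hI0, hI, hIh⟩ : ∃ I : Finset (Fin (K + 1)), 0 ∈ I ∧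
      (∑ k ∈ I, (n k : ℝ)) * δ ^ 2 ≤ v ^ 2 * ((m₁ : ℝ) * m₂) / 4 ∧
      (I = Finset.univ ∨ (s : ℝ) * (s * (max m₁ m₂ : ℕ) * δ ^ 2) ≤ h ^ 2) := by
    rcases hcase with hc | ⟨hc, hc'⟩
    · exact ⟨Finset.univ, Finset.mem_univ _, by exact_mod_cast hc, Or.inl rfl⟩
    · exact ⟨{0}, Finset.mem_singleton_self _, by simpa using hc, Or.inr hc'⟩
  obtain ⟨b, hb, hb4⟩ := exists_vertex_le_frobNorm_sq h₁ h₂ hV S I hδ (by rwa [hVv]) hf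
  have hA0 : cubeParam I δ b 0 = cubeMatrix δ b := by simp [cubeParam, hI0]
  refine ⟨cubeParam I δ b, cubeParam_mem_paramSpace hh hI0 hsr (hrank δ b hb) ?_, ?_⟩
  · refine hIh.imp_right fun hle => le_trans ?_ hle
    have hbS : (b.card : ℝ) ≤ s * (max m₁ m₂ : ℕ) := by
      exact_mod_cast (Finset.card_le_card hb).trans_eq hS
    gcongr
  · rw [hA0]
    have hset : MeasurableSet {x : DataSpace m₁ m₂ K n |
        S.card * δ ^ 2 / 32 ≤ frobNorm (f x - cubeMatrix δ b) ^ 2} := by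
      refine measurableSet_le measurable_const ?_
      simp_rw [frobNorm_sq, Matrix.sub_apply]
      exact Finset.measurable_sum _ fun j _ => Finset.measurable_sum _ fun l _ =>
        (((measurable_entry j l).comp hf).sub_const _).pow_const 2
    rw [← hlaw.map_eq, AEMeasurable.map_map_of_aemeasurable
      (measurable_dataOf _).aemeasurable hlaw.aemeasurable, measureReal_def,
      Measure.map_apply_of_aemeasurable
        ((measurable_dataOf _).comp_aemeasurable hlaw.aemeasurable) hset] at hb4
    have hne := (ENNReal.toReal_pos_iff.1 (lt_of_lt_of_le (by norm_num) hb4)).2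
    have h4 : (1 / 4 : ℝ≥0∞) = ENNReal.ofReal (1 / 4) := by
      rw [ENNReal.ofReal_div_of_pos (by norm_num)]; simp
    rw [h4]
    refine (ENNReal.ofReal_le_of_le_toReal hb4).trans (le_of_eq ?_)
    rw [hS]
    push_cast
    rfl

/-! ### The choice of the hypercube -/

lemma lowerRate_eq_zero {m₁ m₂ r n₀ N : ℕ} {v h : ℝ} (hvr : v = 0 ∨ r = 0) :
    lowerRate m₁ m₂ r n₀ N v h = 0 := by
  have h0 : v ^ 2 * (r : ℝ) = 0 := by rcases hvr with rfl | rfl <;> simp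
  rw [lowerRate, h0, zero_mul, zero_div, zero_div, zero_add, min_eq_left]
  refine le_min (Real.sqrt_nonneg _) (by positivity)

/-- The number of lines `s` and the side `δ` of a hypercube whose separation reaches the second
term of the rate, if the sources are uninformative. With `δ₀` the largest side below the noise level
of the target sample, the three terms of the minimum correspond to `s = r` and `δ = δ₀`, to
`s = ⌊h / (δ₀ √M)⌋` and `δ = δ₀`, and to a single line whose entries are shrunk to norm `h`. -/
lemma exists_cube_of_target {m₁ m₂ r n₀ : ℕ} {v h : ℝ} (h₁ : 0 < m₁) (h₂ : 0 < m₂) (hr : 0 < r)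
    (hn₀ : 0 < n₀) (hv : 0 < v) (hh : 0 ≤ h) :
    ∃ s ≤ r, ∃ δ : ℝ, 0 ≤ δ ∧ n₀ * δ ^ 2 ≤ v ^ 2 * ((m₁ : ℝ) * m₂) / 4 ∧
      (s : ℝ) * (s * (max m₁ m₂ : ℕ) * δ ^ 2) ≤ h ^ 2 ∧
      min (v ^ 2 * r * (max m₁ m₂ : ℕ) / n₀) (min (cTerm m₁ m₂ n₀ v h) (h ^ 2 / ((m₁ : ℝ) * m₂)))
        / 128 ≤ s * (max m₁ m₂ : ℕ) * δ ^ 2 / 32 / ((m₁ : ℝ) * m₂) := by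
  have hM : (0 : ℝ) < (max m₁ m₂ : ℕ) := by exact_mod_cast lt_max_of_lt_left h₁
  set M : ℝ := ((max m₁ m₂ : ℕ) : ℝ) with hMdef
  have hm : (0 : ℝ) < (m₁ : ℝ) * m₂ := by positivity
  rw [cTerm, ← hMdef]
  set m : ℝ := (m₁ : ℝ) * m₂ with hmdef
  have hn : (0 : ℝ) < n₀ := by exact_mod_cast hn₀
  obtain ⟨δ₀, hδ₀, hδ₀n⟩ : ∃ δ₀ : ℝ, 0 < δ₀ ∧ n₀ * δ₀ ^ 2 = v ^ 2 * m / 4 := by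
    refine ⟨√(v ^ 2 * m / 4 / n₀), Real.sqrt_pos.2 (by positivity), ?_⟩
    rw [Real.sq_sqrt (by positivity)]
    field_simp
  have hv2 : v ^ 2 = 4 * n₀ * δ₀ ^ 2 / m := by
    field_simp
    linarith
  obtain ⟨w, hw, hwM⟩ : ∃ w : ℝ, 0 < w ∧ w ^ 2 = M := ⟨√M, Real.sqrt_pos.2 hM, Real.sq_sqrt hM.le⟩
  have hC : √(h ^ 2 / m * (v ^ 2 * M / n₀)) = 2 * h * δ₀ * w / m := by
    rw [Real.sqrt_eq_iff_mul_self_eq (by positivity) (by positivity), hv2, ← hwM]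
    field_simp
    ring
  have hA : v ^ 2 * r * M / n₀ = 4 * (r * M * δ₀ ^ 2 / m) := by
    rw [hv2]; field_simp
  rw [hC, hA]
  rcases lt_or_ge h (δ₀ * w) with hlt | hge
  · refine ⟨1, hr, h / w, by positivity, ?_, ?_, ?_⟩
    · rw [← hδ₀n]
      have : h / w ≤ δ₀ := by rw [div_le_iff₀ hw]; exact hlt.le
      gcongr
    · rw [div_pow, hwM]
      field_simp
      simp
    · rw [div_pow, hwM]
      have h2 : (1 : ℕ) * M * (h ^ 2 / M) / 32 / m = h ^ 2 / m / 32 := by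
        push_cast; field_simp
      rw [h2]
      have h0 : 0 ≤ h ^ 2 / m := by positivity
      have := (min_le_right (4 * (r * M * δ₀ ^ 2 / m)) _).trans
        (min_le_right (2 * h * δ₀ * w / m) (h ^ 2 / m))
      linarith
  · have hbound : ∀ s : ℕ, (s : ℝ) ≤ h / (δ₀ * w) → (s : ℝ) * (s * M * δ₀ ^ 2) ≤ h ^ 2 := by
      intro s hs
      rw [le_div_iff₀ (by positivity)] at hs
      calc (s : ℝ) * (s * M * δ₀ ^ 2) = (s * (δ₀ * w)) ^ 2 := by rw [← hwM]; ring
        _ ≤ h ^ 2 := by gcongr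
    rcases le_total r ⌊h / (δ₀ * w)⌋₊ with hrq | hrq
    · refine ⟨r, le_rfl, δ₀, hδ₀.le, hδ₀n.le, hbound r ((Nat.le_floor_iff (by positivity)).1 hrq),
        ?_⟩
      have := min_le_left (4 * (r * M * δ₀ ^ 2 / m)) (min (2 * h * δ₀ * w / m) (h ^ 2 / m))
      have h2 : r * M * δ₀ ^ 2 / 32 / m = 4 * (r * M * δ₀ ^ 2 / m) / 128 := by ring
      rw [h2]
      linarith
    · refine ⟨_, hrq, δ₀, hδ₀.le, hδ₀n.le, hbound _ (Nat.floor_le (by positivity)), ?_⟩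
      have := (min_le_right (4 * (r * M * δ₀ ^ 2 / m)) _).trans
        (min_le_left (2 * h * δ₀ * w / m) (h ^ 2 / m))
      have hq1 : 1 ≤ h / (δ₀ * w) := by rwa [le_div_iff₀ (by positivity), one_mul]
      -- Rounding down a number `≥ 1` loses at most a factor `2`.
      have hq : h / (δ₀ * w) / 2 ≤ ⌊h / (δ₀ * w)⌋₊ := by
        have h3 := Nat.lt_floor_add_one (h / (δ₀ * w))
        have h4 : (1 : ℝ) ≤ ⌊h / (δ₀ * w)⌋₊ := by
          exact_mod_cast (Nat.one_le_floor_iff _).2 hq1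
        linarith
      calc _ ≤ 2 * h * δ₀ * w / m / 128 := by linarith
        _ = h / (δ₀ * w) / 2 * M * δ₀ ^ 2 / 32 / m := by
          rw [← hwM]; field_simp; ring
        _ ≤ _ := by gcongr

/-- A hypercube whose separation is of the order of the whole rate. In the first alternative all the
`N` observations may depend on its vertex; in the second one only those of the target do, and the
vertices have nuclear norm at most `h`. -/
lemma exists_cube {m₁ m₂ r n₀ N : ℕ} {v h : ℝ} (h₁ : 0 < m₁) (h₂ : 0 < m₂) (hr : 0 < r)
    (hn₀ : 0 < n₀) (hN : 0 < N) (hv : 0 < v) (hh : 0 ≤ h) :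
    ∃ s ≤ r, ∃ δ : ℝ, 0 ≤ δ ∧
      ((N : ℝ) * δ ^ 2 ≤ v ^ 2 * ((m₁ : ℝ) * m₂) / 4 ∨
        (n₀ * δ ^ 2 ≤ v ^ 2 * ((m₁ : ℝ) * m₂) / 4 ∧
          (s : ℝ) * (s * (max m₁ m₂ : ℕ) * δ ^ 2) ≤ h ^ 2)) ∧
      1 / 256 * lowerRate m₁ m₂ r n₀ N v h ≤
        s * (max m₁ m₂ : ℕ) * δ ^ 2 / 32 / ((m₁ : ℝ) * m₂) := by
  have hm : (0 : ℝ) < (m₁ : ℝ) * m₂ := by positivity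
  rw [lowerRate]
  rcases le_total (v ^ 2 * r * (max m₁ m₂ : ℕ) / N) (min (v ^ 2 * r * (max m₁ m₂ : ℕ) / n₀)
      (min (cTerm m₁ m₂ n₀ v h) (h ^ 2 / ((m₁ : ℝ) * m₂)))) with hle | hle
  · obtain ⟨s, hs, δ, hδ, hn, hsh, hrate⟩ := exists_cube_of_target h₁ h₂ hr hn₀ hv hh
    exact ⟨s, hs, δ, hδ, Or.inr ⟨hn, hsh⟩, by linarith⟩
  · have hNpos : (0 : ℝ) < N := by exact_mod_cast hN
    have hsq : √(v ^ 2 * ((m₁ : ℝ) * m₂) / 4 / N) ^ 2 = v ^ 2 * ((m₁ : ℝ) * m₂) / 4 / N :=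
      Real.sq_sqrt (by positivity)
    refine ⟨r, le_rfl, √(v ^ 2 * ((m₁ : ℝ) * m₂) / 4 / N), Real.sqrt_nonneg _, Or.inl ?_, ?_⟩
    · rw [hsq, mul_div_cancel₀ _ hNpos.ne']
    · rw [hsq]
      have : r * (max m₁ m₂ : ℕ) * (v ^ 2 * ((m₁ : ℝ) * m₂) / 4 / N) / 32 / ((m₁ : ℝ) * m₂) =
          v ^ 2 * r * (max m₁ m₂ : ℕ) / N / 128 := by
        field_simp; norm_num
      rw [this]
      linarith

end TransferMC

theorem theorem2 :
    ∃ C : ℝ, 0 < C ∧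
      ∀ (m₁ m₂ K r : ℕ) (n : Fin (K + 1) → ℕ) (v h : ℝ),
        0 < m₁ → 0 < m₂ → r ≤ min m₁ m₂ → 0 < n 0 → 0 ≤ v → 0 ≤ h →
      ∀ (Ω : Type*) [MeasurableSpace Ω] (μ : Measure Ω) [IsProbabilityMeasure μ]
        (X : (k : Fin (K + 1)) → Fin (n k) → Ω → Matrix (Fin m₁) (Fin m₂) ℝ)
        (ξ : (k : Fin (K + 1)) → Fin (n k) → Ω → ℝ),
        (∀ k i, HasLaw (X k i) (TransferMC.uniformSampling m₁ m₂) μ) →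
        (∀ k i, HasLaw (ξ k i) (gaussianReal 0 (Real.toNNReal (v ^ 2))) μ) →
        (∀ k i, IndepFun (X k i) (ξ k i) μ) →
        iIndepFun (fun (p : (k : Fin (K + 1)) × Fin (n k)) (ω : Ω) =>
          (X p.1 p.2 ω, ξ p.1 p.2 ω)) μ →
        (1 / 4 : ℝ≥0∞) ≤
          ⨅ f : TransferMC.Estimator m₁ m₂ K n,
            ⨆ A ∈ TransferMC.paramSpace m₁ m₂ K r h,
              μ {ω | C * TransferMC.lowerRate m₁ m₂ r (n 0) (∑ k, n k) v h ≤
                TransferMC.frobNorm (f.1 (TransferMC.observations X ξ A ω) - A 0) ^ 2 /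
                  ((m₁ : ℝ) * m₂)} := by
  refine ⟨1 / 256, by norm_num, ?_⟩
  intro m₁ m₂ K r n v h h₁ h₂ hr hn₀ hv hh Ω _ μ _ X ξ hX hξ hXξ hind
  refine le_iInf fun f => ?_
  by_cases hvr : v = 0 ∨ r = 0
  · have hA : (fun _ => 0 : Fin (K + 1) → Matrix (Fin m₁) (Fin m₂) ℝ) ∈
        TransferMC.paramSpace m₁ m₂ K r h :=
      ⟨by simp, fun k => by simpa [TransferMC.nuclearNorm_zero] using hh⟩
    refine le_trans ?_ (le_iSup₂_of_le _ hA le_rfl)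
    rw [TransferMC.lowerRate_eq_zero hvr, mul_zero]
    have huniv : {ω | 0 ≤ TransferMC.frobNorm
        (f.1 (TransferMC.observations X ξ (fun _ => 0) ω) - 0) ^ 2 / ((m₁ : ℝ) * m₂)} =
        Set.univ := Set.eq_univ_of_forall fun ω => by
      simp only [Set.mem_ofPred_eq]
      positivity
    rw [huniv, measure_univ]
    exact ENNReal.div_le_of_le_mul (by norm_num)
  · push Not at hvr
    have hm : (0 : ℝ) < (m₁ : ℝ) * m₂ := by positivity
    have hN : 0 < ∑ k, n k := hn₀.trans_le (Finset.single_le_sum (fun _ _ => Nat.zero_le _)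
      (Finset.mem_univ 0))
    have hvpos : 0 < v := lt_of_le_of_ne hv hvr.1.symm
    obtain ⟨s, hs, δ, hδ, hcase, hrate⟩ := TransferMC.exists_cube (h := h) h₁ h₂
      (Nat.pos_of_ne_zero hvr.2) hn₀ hN hvpos hh
    obtain ⟨A, hA, hA4⟩ := TransferMC.exists_mem_paramSpace_le_frobNorm_sq h₁ h₂ hr hvpos hh hδ hs
      hcase (TransferMC.hasLaw_noiseLaw h₁ h₂ hX hξ hXξ hind) f.2
    refine le_iSup₂_of_le A hA (hA4.trans (measure_mono fun ω hω => ?_))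
    exact hrate.trans (div_le_div_of_nonneg_right hω hm.le)
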